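/- **Super Harmonic algorithms.** A Super Harmonic bin packing algorithm $A$ is given by integers $k\ge 1$ and $0\le K\le k$; thresholds $1=t_1>t_2>\dots>t_k>t_{k+1}=\epsilon>0$; constants $\alpha_1,\dots,\alpha_k\in[0,1]$; integers $\beta_1,\dots,\beta_k\ge 1$ (usually $\beta_i=\lfloor 1/t_i\rfloor$); spaces $0=\Delta_0<\Delta_1<\dots<\Delta_K<1/2$; and a map $\phi:\{1,\dots,k\}\to\{0,\dots,K\}$ with $\Delta_{\phi(i)}\le 1-t_i\beta_i$. It is required that $\alpha_i=0$ whenever $t_i>\Delta_K$. Put $\gamma_i=0$ if $t_i>\Delta_K$, and $\gamma_i=\max\{1,\lfloor\Delta_1/t_i\rfloor\}$ otherwise. For $t_i\le\Delta_K$ put $\varphi(i)=\min\{j: 1\le j\le K,\ t_i\le\Delta_j\}$. An item of size $x\in(0,1]$ has type $i\le k$ if $x\in I_i=(t_{i+1},t_i]$, and type $k+1$ if $x\in I_{k+1}=(0,\epsilon]$. Items of type $k+1$ are packed by Next Fit into bins of their own. For each $i\le k$, $A$ counts the items of type $i$ ($s_i$) and the red items of type $i$ ($e_i$). When an item of type $i\le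 k$ arrives, $s_i$ is increased by 1. If then $e_i<\lfloor\alpha_i s_i\rfloor$, the item is red and $e_i$ is increased by 1; otherwise the item is blue. Bins belong to groups: $(i)$ (blue items of type $i$ only, $\phi(i)=0$), $(i,?)$ (so far only blue items of type $i$, $\phi(i)\neq0$), $(?,j)$ (so far only red items of type $j$), and $(i,j)$ (blue items of type $i$ and red items of type $j$). * A red item of type $i$ is put into a bin of group $(?,i)$ with fewer than $\gamma_i$ items if there is one; else into a bin of some group $(j,i)$ with fewer than $\gamma_i$ red items if there is one; else into a bin of some group $(j,?)$ with $\gamma_i t_i\le\Delta_{\phi(j)}$ if there is one, which then becomes a bin of group $(j,i)$; else into a new bin of group $(?,i)$. * A blue item of type $i$ with $\phi(i)=0$ is put into a bin of group $(i)$ with fewer than $\beta_i$ items if there is one, else into a new bin of group $(i)$. * A blue item of type $i$ with $\phi(i)\ne0$ is put into a bin of group $(i,?)$ or some group $(i,j)$ with fewer than $\beta_i$ blue items if there is one; else into a bin of some group $(?,j)$ with $\gamma_j t_j\le\Delta_{\phi(i)}$ if there is one, which then becomes a bin of group $(i,j)$; else into a new bin of group $(i,?)$. Where several bins are eligible, the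 choice is arbitrary. **The algorithm $G\&P_A$.** Let $0<r<1$ and $c>1$ be constants. The input is a sequence of rectangles of width $x\in(0,1]$ and height $y\in(0,1]$, packed online into a strip of width $1$. A rectangle with $x\le\epsilon$ is narrow, the others are wide. For a narrow rectangle with $r^{s+1}<y\le r^s$, $s\in\{0,1,2,\dots\}$: if there is an open shelf of height $r^s$ and its used width plus $x$ is at most $1$, then the rectangle is put there; otherwise that shelf (if any) is closed and a new shelf of height $r^s$ is opened for the rectangle. For a wide rectangle of type $i$: if there is a slip of type $i$ (a rectangle of width $t_i$ and height $c$) with packed height less than $c-1$, then the rectangle is stacked into it; otherwise a new slip of type $i$ is created for the rectangle, and this slip is at once packed, as an item of size $t_i$, by $A$ into bins of width $1$ and height $c$. The cost $cost_A(L)$ on the sequence $L$ is the total height used: the sum of the heights of all shelves, open or closed, plus $c$ times the number of bins. **Weights.** Let $b_0,\dots,b_K,r_1,\dots,r_K$ be the unit vectors of $\mathbb R^{2K+1}$. For $x\in(0,1]$ put $$w_A(x)=\begin{cases}(1-\alpha_i)\dfrac{b_{\phi(i)}}{\beta_i}+\alpha_i\dfrac{r_{\varphi(i)}}{\gamma_i},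 & x\in I_i,\ i\le k,\\[2mm] x\,\dfrac{b_0}{1-\epsilon}, & x\in I_{k+1},\end{cases}$$ where the second summand of the first line is $0$ if $t_i>\Delta_K$. For a rectangle $P$ of width $x$ and height $y$ put $w_A(P)=y\,w_A(x)$. The consolidation function $\xi_A:\mathbb R^{2K+1}\to\mathbb R$ is $$\xi_A(\mathbf x)=\mathbf x\cdot b_0+\max_{1\le j\le K+1}\min\Big\{\sum_{i=j}^{K}\mathbf x\cdot r_i+\sum_{i=1}^{K}\mathbf x\cdot b_i,\ \sum_{i=1}^{K}\mathbf x\cdot r_i+\sum_{i=1}^{j-1}\mathbf x\cdot b_i\Big\}.$$ **Lemma.** For every Super Harmonic algorithm $A$, every $r\in(0,1)$ and every $c>1$ there is a constant $C$, depending only on $A$, $r$ and $c$, such that for every finite sequence $L=(P_1,\dots,P_n)$ of rectangles with widths and heights in $(0,1]$, and whatever eligible bins are chosen, $$cost_A(L)\le\max\Big\{\frac{c}{c-1},\frac1r\Big\}\,\xi_A\Big(\sum_{i=1}^n w_A(P_i)\Big)+C.$$ -/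

import Mathlib

/-- The parameters of a Super Harmonic algorithm with `k` types of large items and `K` spaces
for red items. Types and spaces are numbered from `0` here: type `i : Fin k` is the type number
`i + 1` in the usual numbering, with thresholds `t i.castSucc` (upper) and `t i.succ` (lower),
so `t 0, …, t k` are the usual `t₁, …, t_{k+1}`; `Δ 0, …, Δ K` are numbered as usual. -/
structure SuperHarmonic (k K : ℕ) where
  k_pos : 0 < k
  K_le : K ≤ k
  /-- the thresholds `1 = t₁ > t₂ > ⋯ > t_{k+1} = ε > 0` -/
  t : Fin (k + 1) → ℝ
  t_first : t 0 = 1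
  t_anti : StrictAnti t
  t_last_pos : 0 < t (Fin.last k)
  /-- the proportion of red items -/
  α : Fin k → ℝ
  α_nonneg : ∀ i, 0 ≤ α i
  α_le_one : ∀ i, α i ≤ 1
  /-- the number of blue items of type `i` in a completed bin -/
  β : Fin k → ℕ
  β_pos : ∀ i, 1 ≤ β i
  /-- the spaces `0 = Δ₀ < Δ₁ < ⋯ < Δ_K < 1/2` for red items -/
  Δ : Fin (K + 1) → ℝ
  Δ_zero : Δ 0 = 0
  Δ_mono : StrictMono Δ
  Δ_last_lt : Δ (Fin.last K) < 1 / 2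
  /-- `Δ (φ i)` is the space left for red items in a bin with blue items of type `i`;
  `φ i = 0` means that no red items are accepted -/
  φ : Fin k → Fin (K + 1)
  /-- the reserved space is at most `δ i = 1 - t i * β i` -/
  Δ_φ_le : ∀ i, Δ (φ i) ≤ 1 - t i.castSucc * β i
  /-- types that fit into none of the spaces have no red items -/
  α_eq_zero : ∀ i, Δ (Fin.last K) < t i.castSucc → α i = 0

namespace SuperHarmonic

variable {k K : ℕ} (A : SuperHarmonic k K)

/-- The threshold `ε = t_{k+1}` below which items are small. -/
def ε : ℝ := A.t (Fin.last k)

/-- The upper end `tᵢ` of the interval of type `i`. -/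
def top (i : Fin k) : ℝ := A.t i.castSucc

/-- The interval `Iᵢ = (t_{i+1}, tᵢ]`. -/
def interval (i : Fin k) : Set ℝ := Set.Ioc (A.t i.succ) (A.t i.castSucc)

open Classical in
/-- The type of an item of size `x ∈ (0, 1]`: `some i` if `x ∈ Iᵢ` with `i ≤ k` (the intervals
are disjoint), and `none` if `x ∈ I_{k+1} = (0, ε]`. -/
noncomputable def itemType (x : ℝ) : Option (Fin k) :=
  if h : ∃ i, x ∈ A.interval i then some h.choose else none

/-- `γᵢ`: the number of red items of type `i` in a completed bin. (If `K = 0`, then every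
`tᵢ > Δ_K = 0`, and `Δ 1` is never used.) -/
noncomputable def γ (i : Fin k) : ℕ :=
  if A.Δ (Fin.last K) < A.top i then 0 else max 1 ⌊A.Δ 1 / A.top i⌋₊

/-- `min {j | tᵢ ≤ Δⱼ, 1 ≤ j ≤ K}`, where `j : Fin K` stands for the space number `j + 1`;
it is `⊤` if there is no such `j`. -/
noncomputable def redClass (i : Fin k) : WithTop (Fin K) :=
  (Finset.univ.filter fun j : Fin K => A.top i ≤ A.Δ j.succ).min

/-! ### The bin packing algorithm -/

/-- The groups of bins that hold large items. -/
inductive Group (k : ℕ) where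
  /-- group `(i)`: blue items of type `i` only, no red items accepted -/
  | single (i : Fin k)
  /-- group `(i,?)` -/
  | blueOnly (i : Fin k)
  /-- group `(?,j)` -/
  | redOnly (j : Fin k)
  /-- group `(i,j)`: blue items of type `i` and red items of type `j` -/
  | mixed (i j : Fin k)

/-- A bin with its group and the numbers of blue and of red items in it. -/
structure Bin (k : ℕ) where
  group : Group k
  blue : ℕ
  red : ℕ

/-- `A.BlueAvail B i b`: `b` is a bin of group `(i,?)` or `(i,j)`, for any `j`, among the bins
`B`, with fewer than `βᵢ` items of type `i`. -/
def BlueAvail (B : Multiset (Bin k)) (i : Fin k) (b : Bin k) : Prop :=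
  b ∈ B ∧ (b.group = .blueOnly i ∨ ∃ j, b.group = .mixed i j) ∧ b.blue < A.β i

/-- `b` is a bin of group `(i)` among the bins `B` with fewer than `βᵢ` items. -/
def SingleAvail (B : Multiset (Bin k)) (i : Fin k) (b : Bin k) : Prop :=
  b ∈ B ∧ b.group = .single i ∧ b.blue < A.β i

/-- `b` is a bin of group `(?,i)` among the bins `B` with fewer than `γᵢ` items. -/
def RedOnlyAvail (B : Multiset (Bin k)) (i : Fin k) (b : Bin k) : Prop :=
  b ∈ B ∧ b.group = .redOnly i ∧ b.red < A.γ i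

/-- `b` is a bin of group `(j,i)`, for any `j`, among the bins `B` with fewer than `γᵢ` red
items. -/
def RedMixedAvail (B : Multiset (Bin k)) (i : Fin k) (b : Bin k) : Prop :=
  b ∈ B ∧ (∃ j, b.group = .mixed j i) ∧ b.red < A.γ i

/-- Blue items of type `i` and red items of type `j` can share a bin: `γⱼ tⱼ ≤ Δ_{φ(i)}`. -/
def Compatible (i j : Fin k) : Prop := A.γ j * A.top j ≤ A.Δ (A.φ i)

/-- `A.PlaceRed i B B'`: packing a red item of type `i` may turn the bins `B` into `B'`. Where
several bins are eligible, any of them may be chosen. -/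
inductive PlaceRed (i : Fin k) : Multiset (Bin k) → Multiset (Bin k) → Prop
  | redOnly (b : Bin k) (M : Multiset (Bin k)) (hb : A.RedOnlyAvail (b ::ₘ M) i b) :
      PlaceRed i (b ::ₘ M) ({ b with red := b.red + 1 } ::ₘ M)
  | mixed (b : Bin k) (M : Multiset (Bin k)) (h₁ : ∀ b', ¬ A.RedOnlyAvail (b ::ₘ M) i b')
      (hb : A.RedMixedAvail (b ::ₘ M) i b) :
      PlaceRed i (b ::ₘ M) ({ b with red := b.red + 1 } ::ₘ M)
  | convert (b : Bin k) (M : Multiset (Bin k)) (j : Fin k)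
      (h₁ : ∀ b', ¬ A.RedOnlyAvail (b ::ₘ M) i b')
      (h₂ : ∀ b', ¬ A.RedMixedAvail (b ::ₘ M) i b')
      (hb : b.group = .blueOnly j) (hj : A.Compatible j i) :
      PlaceRed i (b ::ₘ M) ({ b with group := .mixed j i, red := b.red + 1 } ::ₘ M)
  | newBin (B : Multiset (Bin k))
      (h₁ : ∀ b', ¬ A.RedOnlyAvail B i b')
      (h₂ : ∀ b', ¬ A.RedMixedAvail B i b')
      (h₃ : ∀ b' ∈ B, ∀ j, b'.group = .blueOnly j → ¬ A.Compatible j i) :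
      PlaceRed i B (⟨.redOnly i, 0, 1⟩ ::ₘ B)

/-- `A.PlaceBlue i B B'`: packing a blue item of type `i` may turn the bins `B` into `B'`. Where
several bins are eligible, any of them may be chosen. -/
inductive PlaceBlue (i : Fin k) : Multiset (Bin k) → Multiset (Bin k) → Prop
  | single (b : Bin k) (M : Multiset (Bin k)) (hφ : A.φ i = 0)
      (hb : A.SingleAvail (b ::ₘ M) i b) :
      PlaceBlue i (b ::ₘ M) ({ b with blue := b.blue + 1 } ::ₘ M)
  | newSingle (B : Multiset (Bin k)) (hφ : A.φ i = 0) (h₁ : ∀ b', ¬ A.SingleAvail B i b') :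
      PlaceBlue i B (⟨.single i, 1, 0⟩ ::ₘ B)
  | add (b : Bin k) (M : Multiset (Bin k)) (hφ : A.φ i ≠ 0)
      (hb : A.BlueAvail (b ::ₘ M) i b) :
      PlaceBlue i (b ::ₘ M) ({ b with blue := b.blue + 1 } ::ₘ M)
  | convert (b : Bin k) (M : Multiset (Bin k)) (j : Fin k) (hφ : A.φ i ≠ 0)
      (h₁ : ∀ b', ¬ A.BlueAvail (b ::ₘ M) i b')
      (hb : b.group = .redOnly j) (hj : A.Compatible i j) :
      PlaceBlue i (b ::ₘ M) ({ b with group := .mixed i j, blue := b.blue + 1 } ::ₘ M)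
  | newBin (B : Multiset (Bin k)) (hφ : A.φ i ≠ 0)
      (h₁ : ∀ b', ¬ A.BlueAvail B i b')
      (h₂ : ∀ b' ∈ B, ∀ j, b'.group = .redOnly j → ¬ A.Compatible i j) :
      PlaceBlue i B (⟨.blueOnly i, 1, 0⟩ ::ₘ B)

/-- A state of the bin packing algorithm. -/
structure State (k : ℕ) where
  /-- the number of items of each type so far -/
  s : Fin k → ℕ
  /-- the number of red items of each type so far -/
  e : Fin k → ℕ
  /-- the bins with large items -/
  bins : Multiset (Bin k)
  /-- the level of the currently open bin for small items, if there is one -/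
  smallOpen : Option ℝ
  /-- the number of bins with small items -/
  smallBins : ℕ

/-- The state before the first item. -/
def State.init (k : ℕ) : State k := ⟨fun _ => 0, fun _ => 0, 0, none, 0⟩

/-- The number of bins used so far. -/
def State.cost (S : State k) : ℕ := Multiset.card S.bins + S.smallBins

/-- `A.Step x S S'`: on an item of size `x`, the algorithm may pass from state `S` to `S'`. -/
inductive Step (x : ℝ) : State k → State k → Prop
  | smallFit (S : State k) (u : ℝ) (hx : A.itemType x = none) (hu : S.smallOpen = some u)
      (hfit : u + x ≤ 1) :
      Step x S { S with smallOpen := some (u + x) }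
  | smallNew (S : State k) (hx : A.itemType x = none)
      (hno : ∀ u, S.smallOpen = some u → 1 < u + x) :
      Step x S { S with smallOpen := some x, smallBins := S.smallBins + 1 }
  | red (S : State k) (i : Fin k) (B' : Multiset (Bin k)) (hx : A.itemType x = some i)
      (hcol : S.e i < ⌊A.α i * ((S.s i + 1 : ℕ) : ℝ)⌋₊) (hB : A.PlaceRed i S.bins B') :
      Step x S { S with
        s := Function.update S.s i (S.s i + 1)
        e := Function.update S.e i (S.e i + 1)
        bins := B' }
  | blue (S : State k) (i : Fin k) (B' : Multiset (Bin k)) (hx : A.itemType x = some i)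
      (hcol : ¬ S.e i < ⌊A.α i * ((S.s i + 1 : ℕ) : ℝ)⌋₊) (hB : A.PlaceBlue i S.bins B') :
      Step x S { S with
        s := Function.update S.s i (S.s i + 1)
        bins := B' }

/-! ### The strip packing algorithm -/

/-- A state of the strip packing algorithm. -/
structure GPState (k : ℕ) where
  /-- for every `s`, the used width of the open shelf of height `r ^ s`, if there is one -/
  shelf : ℕ → Option ℝ
  /-- the total height of all shelves, open or closed -/
  shelfHeight : ℝ
  /-- for every type `i`, the packed heights of the slips of type `i` -/
  slips : Fin k → Multiset ℝ
  /-- the state of the bin packing algorithm, whose items are the slips and whose bins are the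
  bins of width `1` and height `c` -/
  packing : State k

/-- The state before the first rectangle. -/
def GPState.init (k : ℕ) : GPState k := ⟨fun _ => none, 0, fun _ => 0, State.init k⟩

/-- The height of the strip used so far: the shelves, and the bins of height `c`. -/
noncomputable def GPState.cost (c : ℝ) (S : GPState k) : ℝ := S.shelfHeight + c * S.packing.cost

/-- `A.GPStep r c P S S'`: on the rectangle `P = (width, height)`, the strip packing algorithm
with parameters `r` and `c` that is built on `A` may pass from state `S` to `S'`. -/
inductive GPStep (r c : ℝ) (P : ℝ × ℝ) : GPState k → GPState k → Prop
  | shelfFit (S : GPState k) (s : ℕ) (u : ℝ) (hP : A.itemType P.1 = none)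
      (hs₁ : r ^ (s + 1) < P.2) (hs₂ : P.2 ≤ r ^ s)
      (hu : S.shelf s = some u) (hfit : u + P.1 ≤ 1) :
      GPStep r c P S { S with shelf := Function.update S.shelf s (some (u + P.1)) }
  | shelfNew (S : GPState k) (s : ℕ) (hP : A.itemType P.1 = none)
      (hs₁ : r ^ (s + 1) < P.2) (hs₂ : P.2 ≤ r ^ s)
      (hno : ∀ u, S.shelf s = some u → 1 < u + P.1) :
      GPStep r c P S { S with
        shelf := Function.update S.shelf s (some P.1)
        shelfHeight := S.shelfHeight + r ^ s }
  | slipFit (S : GPState k) (i : Fin k) (h : ℝ) (M : Multiset ℝ) (hP : A.itemType P.1 = some i)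
      (hM : S.slips i = h ::ₘ M) (hh : h < c - 1) :
      GPStep r c P S { S with slips := Function.update S.slips i ((h + P.2) ::ₘ M) }
  | slipNew (S : GPState k) (i : Fin k) (T : State k) (hP : A.itemType P.1 = some i)
      (hno : ∀ h ∈ S.slips i, ¬ h < c - 1) (hT : A.Step (A.top i) S.packing T) :
      GPStep r c P S { S with
        slips := Function.update S.slips i (P.2 ::ₘ S.slips i)
        packing := T }

/-- `A.GPRun r c L S`: the strip packing algorithm may reach the state `S` after it has processed
the rectangles of `L` one after the other. -/
inductive GPRun (r c : ℝ) : List (ℝ × ℝ) → GPState k → Prop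
  | nil : GPRun r c [] (GPState.init k)
  | snoc (L : List (ℝ × ℝ)) (P : ℝ × ℝ) (S S' : GPState k) (hL : GPRun r c L S)
      (hP : A.GPStep r c P S S') : GPRun r c (L ++ [P]) S'

/-! ### The weighting system -/

/-- The space `ℝ^(2K+1)`, with coordinates for `b₀, …, b_K` and for `r₁, …, r_K`. -/
abbrev WeightSpace (K : ℕ) : Type := (Fin (K + 1) ⊕ Fin K) → ℝ

/-- The unit vectors `b₀, …, b_K`. -/
def bVec (j : Fin (K + 1)) : WeightSpace K := Pi.single (Sum.inl j) 1

/-- The unit vectors `r₁, …, r_K` (`j : Fin K` stands for the number `j + 1`), and `0` for the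
class `⊤` of the types that have no red items. -/
def rVec : WithTop (Fin K) → WeightSpace K
  | none => 0
  | some j => Pi.single (Sum.inr j) 1

/-- The weight of a size `x ∈ (0, 1]`. -/
noncomputable def weight (x : ℝ) : WeightSpace K :=
  match A.itemType x with
  | some i => ((1 - A.α i) / A.β i) • bVec (A.φ i) + (A.α i / A.γ i) • rVec (A.redClass i)
  | none => (x / (1 - A.ε)) • bVec 0

/-- The weight of a rectangle `P = (width, height)`. -/
noncomputable def rectWeight (P : ℝ × ℝ) : WeightSpace K := P.2 • A.weight P.1

/-- The consolidation function. The index `j : Fin (K + 1)` stands for the number `j + 1` in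
`1, …, K + 1`, and `i : Fin K` for the number `i + 1` in `1, …, K`. -/
noncomputable def consolidation (x : WeightSpace K) : ℝ :=
  x (Sum.inl 0) + Finset.univ.sup' Finset.univ_nonempty fun j : Fin (K + 1) =>
    min
      ((∑ i ∈ {i : Fin K | (j : ℕ) ≤ i}, x (Sum.inr i)) + ∑ i : Fin K, x (Sum.inl i.succ))
      ((∑ i : Fin K, x (Sum.inr i)) + ∑ i ∈ {i : Fin K | (i : ℕ) < j}, x (Sum.inl i.succ))

end SuperHarmonic

namespace SuperHarmonic

variable {k K : ℕ} (A : SuperHarmonic k K)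

/-! Each of the three parts of the cost is bounded by weight up to a constant. A closed shelf is
filled beyond width `1 - ε`, and rounding a height up to `r ^ s` loses at most the factor `1 / r`,
so narrow rectangles pay for the shelves, except for open ones of total height at most a geometric
series. At most one slip per type is packed below `c - 1`, so the total slip height of a type is, up
to `c`, at most `c / (c - 1)` times the packed height. Bins with blue (red) items of type `i` number
at most the count of these items over `β i` (`γ i`), plus one.

It remains to avoid paying twice for mixed bins. Compatible groups `(i,?)` and `(?,j)` never
coexist. With `J` the largest `φ i` over the bins `(i,?)`, every bin `(?,j)` therefore needs a space
numbered above `J` (`exists_space_index`). So all bins are covered by those with blue items together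
with those whose red class exceeds `J`, and also by those with red items together with those whose
blue class is at most `J`. These two counts are the two terms of the minimum in `consolidation` at
index `J`. The invariants are `BinsInv`, `PackingInv` and `GPInv`; `GPInv.cost_le` combines them. -/

/-- The type of the blue items in the bins of a group, if there are any. -/
def Group.blueType : Group k → Option (Fin k)
  | .single i => some i
  | .blueOnly i => some i
  | .redOnly _ => none
  | .mixed i _ => some i

/-- The type of the red items in the bins of a group, if there are any. -/
def Group.redType : Group k → Option (Fin k)
  | .single _ => none
  | .blueOnly _ => none
  | .redOnly j => some j
  | .mixed _ j => some j

/-! ### Loads of the bins, by colour and type -/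

/-- The numbers of blue items in the bins with blue items of type `i`. -/
def blueLoads (i : Fin k) (B : Multiset (Bin k)) : Multiset ℕ :=
  (B.filter fun b => b.group.blueType = some i).map Bin.blue

/-- The numbers of red items in the bins with red items of type `i`. -/
def redLoads (i : Fin k) (B : Multiset (Bin k)) : Multiset ℕ :=
  (B.filter fun b => b.group.redType = some i).map Bin.red

theorem blueLoads_cons (i : Fin k) (b : Bin k) (B : Multiset (Bin k)) :
    blueLoads i (b ::ₘ B) =
      if b.group.blueType = some i then b.blue ::ₘ blueLoads i B else blueLoads i B := by
  split_ifs with h <;> simp [blueLoads, h]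

theorem redLoads_cons (i : Fin k) (b : Bin k) (B : Multiset (Bin k)) :
    redLoads i (b ::ₘ B) =
      if b.group.redType = some i then b.red ::ₘ redLoads i B else redLoads i B := by
  split_ifs with h <;> simp [redLoads, h]

theorem mem_blueLoads {i : Fin k} {B : Multiset (Bin k)} {a : ℕ} :
    a ∈ blueLoads i B ↔ ∃ b ∈ B, b.group.blueType = some i ∧ b.blue = a := by
  simp [blueLoads, and_assoc]

theorem mem_redLoads {i : Fin k} {B : Multiset (Bin k)} {a : ℕ} :
    a ∈ redLoads i B ↔ ∃ b ∈ B, b.group.redType = some i ∧ b.red = a := by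
  simp [redLoads, and_assoc]

/-- The loads `M` sum up to `n`, and their number is at most `n / b + 1`. -/
def Filled (b n : ℕ) (M : Multiset ℕ) : Prop :=
  M.sum = n ∧ b * Multiset.card M ≤ n + b

theorem Filled.incr {b n a : ℕ} {M : Multiset ℕ} (h : Filled b n (a ::ₘ M)) :
    Filled b (n + 1) ((a + 1) ::ₘ M) := by
  obtain ⟨h₁, h₂⟩ := h
  simp only [Filled, Multiset.sum_cons, Multiset.card_cons] at *
  omega

/-- If every load is at least `b`, then `b * card M ≤ n` without the additive slack, which leaves
room for one more bin. -/
theorem Filled.add_one {b n : ℕ} {M : Multiset ℕ} (h : Filled b n M) (hM : ∀ a ∈ M, b ≤ a) :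
    Filled b (n + 1) (1 ::ₘ M) := by
  have h₃ := Multiset.card_nsmul_le_sum hM
  obtain ⟨h₁, h₂⟩ := h
  simp only [Filled, Multiset.sum_cons, Multiset.card_cons, smul_eq_mul, mul_add] at *
  rw [mul_comm] at h₃
  omega

/-! ### The invariant of the placement rules -/

/-- The properties of the bins `B` that hold `nb i` blue and `nr i` red items of each type `i`
which are kept by the algorithm. -/
structure BinsInv (B : Multiset (Bin k)) (nb nr : Fin k → ℕ) : Prop where
  blue : ∀ i, Filled (A.β i) (nb i) (blueLoads i B)
  red : ∀ i, Filled (A.γ i) (nr i) (redLoads i B)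
  blue_eq_zero : ∀ b ∈ B, b.group.blueType = none → b.blue = 0
  red_eq_zero : ∀ b ∈ B, b.group.redType = none → b.red = 0
  -- This guarantees that red items in bins have a red class and `γ j ≥ 1`.
  red_top : ∀ b ∈ B, ∀ j, b.group.redType = some j → A.top j ≤ A.Δ (Fin.last K)
  single_iff : ∀ b ∈ B, ∀ i, b.group.blueType = some i → (b.group = .single i ↔ A.φ i = 0)
  not_compatible : ∀ b ∈ B, ∀ b' ∈ B, ∀ i j, b.group = .blueOnly i → b'.group = .redOnly j →
    ¬ A.Compatible i j

variable {A}

theorem binsInv_zero : A.BinsInv 0 0 0 := by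
  constructor <;> simp [Filled, blueLoads, redLoads]

theorem top_pos (i : Fin k) : 0 < A.top i :=
  A.t_last_pos.trans_le (A.t_anti.antitone (Fin.le_last _))

/-- The rules convert or open a bin for a red item only under these two conditions, so this supplies
the fullness needed by `Filled.add_one`. -/
theorem le_redLoads {B : Multiset (Bin k)} {i : Fin k}
    (h₁ : ∀ b', ¬ A.RedOnlyAvail B i b') (h₂ : ∀ b', ¬ A.RedMixedAvail B i b') :
    ∀ a ∈ redLoads i B, A.γ i ≤ a := by
  intro a ha
  obtain ⟨b, hb, hbt, rfl⟩ := mem_redLoads.1 ha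
  by_contra! hlt
  rcases b with ⟨g, n, m⟩
  cases g <;> simp only [Group.redType, reduceCtorEq, Option.some.injEq] at hbt
  · subst hbt; exact h₁ _ ⟨hb, rfl, hlt⟩
  · subst hbt; exact h₂ _ ⟨hb, ⟨_, rfl⟩, hlt⟩

/-- By `single_iff`, when `φ i = 0` the group `(i)` is the only one with blue items of type `i`, so
the rule inspects all relevant bins. -/
theorem BinsInv.le_blueLoads_of_single {B : Multiset (Bin k)} {nb nr : Fin k → ℕ} {i : Fin k}
    (h : A.BinsInv B nb nr) (hφ : A.φ i = 0) (h₁ : ∀ b', ¬ A.SingleAvail B i b') :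
    ∀ a ∈ blueLoads i B, A.β i ≤ a := by
  intro a ha
  obtain ⟨b, hb, hbt, rfl⟩ := mem_blueLoads.1 ha
  by_contra! hlt
  exact h₁ b ⟨hb, (h.single_iff b hb i hbt).2 hφ, hlt⟩

theorem BinsInv.le_blueLoads {B : Multiset (Bin k)} {nb nr : Fin k → ℕ} {i : Fin k}
    (h : A.BinsInv B nb nr) (hφ : A.φ i ≠ 0) (h₁ : ∀ b', ¬ A.BlueAvail B i b') :
    ∀ a ∈ blueLoads i B, A.β i ≤ a := by
  intro a ha
  obtain ⟨b, hb, hbt, rfl⟩ := mem_blueLoads.1 ha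
  by_contra! hlt
  have hs := h.single_iff b hb i hbt
  refine h₁ b ⟨hb, ?_, hlt⟩
  rcases b with ⟨g, n, m⟩
  cases g <;> simp_all [Group.blueType]

theorem exists_redClass {j : Fin k} (h : A.top j ≤ A.Δ (Fin.last K)) :
    ∃ m : Fin K, A.redClass j = m := by
  -- Without spaces, `Δ (Fin.last K) = Δ 0 = 0` lies below every threshold; otherwise the last space
  -- is a candidate for the minimum.
  rcases K with _ | n
  · have h0 := A.Δ_zero
    have htop := top_pos (A := A) j
    simp only [Fin.isValue, Fin.last_zero] at h h0
    linarith
  · exact Finset.min_of_mem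
      (s := Finset.univ.filter fun j' : Fin (n + 1) => A.top j ≤ A.Δ j'.succ) (a := Fin.last n)
      (by simpa using h)

theorem top_le_of_redClass {j : Fin k} {m : Fin K} (h : A.redClass j = m) :
    A.top j ≤ A.Δ m.succ := by
  simpa using Finset.mem_of_min h

theorem γ_of_redClass {j : Fin k} {m : Fin K} (h : A.redClass j = m) :
    A.γ j = max 1 ⌊A.Δ 1 / A.top j⌋₊ :=
  if_neg (not_lt.2 ((top_le_of_redClass h).trans (A.Δ_mono.monotone (Fin.le_last _))))

theorem one_le_γ {j : Fin k} {m : Fin K} (h : A.redClass j = m) : 1 ≤ A.γ j := by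
  rw [γ_of_redClass h]
  exact le_max_left _ _

/-- Either `γ j` red items fit into the smallest space `Δ 1`, or `γ j = 1` and the single item fits
into the space of its class. -/
theorem γ_mul_top_le {j : Fin k} {m : Fin K} (h : A.redClass j = m) :
    A.γ j * A.top j ≤ A.Δ m.succ := by
  rw [γ_of_redClass h]
  rcases le_total 1 ⌊A.Δ 1 / A.top j⌋₊ with h1 | h1
  · rw [max_eq_right h1]
    have h2 : (⌊A.Δ 1 / A.top j⌋₊ : ℝ) ≤ A.Δ 1 / A.top j :=
      Nat.floor_le (Nat.pos_of_floor_pos (by omega)).le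
    calc _ ≤ A.Δ 1 := (le_div_iff₀ (top_pos j)).1 h2
      _ ≤ A.Δ m.succ := A.Δ_mono.monotone (by
        rw [Fin.le_def, Fin.val_succ]
        -- The literal `1 : Fin (K + 1)` has value `1 % (K + 1)`.
        exact (Nat.mod_le 1 (K + 1)).trans (by omega))
  · rw [max_eq_left h1]
    simpa using top_le_of_redClass h

theorem compatible_φ_ne_zero {i j : Fin k} (hj : A.top j ≤ A.Δ (Fin.last K))
    (h : A.Compatible i j) : A.φ i ≠ 0 := by
  intro h0
  obtain ⟨m, hm⟩ := exists_redClass hj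
  have hγ : (0 : ℝ) < A.γ j := by exact_mod_cast one_le_γ hm
  rw [Compatible, h0, A.Δ_zero] at h
  exact absurd h (not_le.2 (mul_pos hγ (top_pos j)))

/-- The delicate field is `not_compatible`: a `(?,i)` bin is opened only when no compatible `(j,?)`
bin exists, and a conversion creates neither kind. -/
theorem BinsInv.placeRed {B B' : Multiset (Bin k)} {nb nr : Fin k → ℕ} {i : Fin k}
    (h : A.BinsInv B nb nr) (hi : A.top i ≤ A.Δ (Fin.last K)) (hB : A.PlaceRed i B B') :
    A.BinsInv B' nb (Function.update nr i (nr i + 1)) := by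
  obtain ⟨hb, hr, hb0, hr0, ht, hs, hc⟩ := h
  cases hB with
  | redOnly b M hav =>
    obtain ⟨-, hg, -⟩ := hav
    rcases b with ⟨g, n, m⟩
    subst hg
    simp only [Multiset.mem_cons, forall_eq_or_imp] at hb0 hr0 ht hs hc
    refine ⟨fun l => ?_, fun l => ?_, ?_, ?_, ?_, ?_, ?_⟩
    · simpa [blueLoads_cons, Group.blueType] using hb l
    · have := hr l
      by_cases hl : l = i
      · subst hl
        simp only [redLoads_cons, Group.redType, if_true, Function.update_self] at this ⊢
        exact this.incr
      · simpa [redLoads_cons, Group.redType, hl, Ne.symm hl] using this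
    all_goals
      simp only [Multiset.mem_cons, forall_eq_or_imp]
      grind [Group.redType, Group.blueType]
  | mixed b M h₁ hav =>
    obtain ⟨-, ⟨j, hg⟩, -⟩ := hav
    rcases b with ⟨g, n, m⟩
    subst hg
    simp only [Multiset.mem_cons, forall_eq_or_imp] at hb0 hr0 ht hs hc
    refine ⟨fun l => ?_, fun l => ?_, ?_, ?_, ?_, ?_, ?_⟩
    · simpa [blueLoads_cons, Group.blueType] using hb l
    · have := hr l
      by_cases hl : l = i
      · subst hl
        simp only [redLoads_cons, Group.redType, if_true, Function.update_self] at this ⊢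
        exact this.incr
      · simpa [redLoads_cons, Group.redType, hl, Ne.symm hl] using this
    all_goals
      simp only [Multiset.mem_cons, forall_eq_or_imp]
      grind [Group.redType, Group.blueType]
  | convert b M j h₁ h₂ hg hj =>
    have hfull := le_redLoads h₁ h₂
    have hφ := compatible_φ_ne_zero hi hj
    rcases b with ⟨g, n, m⟩
    subst hg
    simp only [Multiset.mem_cons, forall_eq_or_imp] at hb0 hr0 ht hs hc
    -- The converted bin had no red items, so it enters the red loads with load exactly 1, as a new
    -- bin would.
    obtain rfl : m = 0 := hr0.1 rfl
    refine ⟨fun l => ?_, fun l => ?_, ?_, ?_, ?_, ?_, ?_⟩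
    · simpa [blueLoads_cons, Group.blueType] using hb l
    · have := hr l
      by_cases hl : l = i
      · subst hl
        simp only [redLoads_cons, Group.redType, if_true, Function.update_self, reduceCtorEq,
          if_false] at this hfull ⊢
        exact this.add_one hfull
      · simpa [redLoads_cons, Group.redType, hl, Ne.symm hl] using this
    all_goals
      simp only [Multiset.mem_cons, forall_eq_or_imp]
      grind [Group.redType, Group.blueType]
  | newBin _ h₁ h₂ h₃ =>
    have hfull := le_redLoads h₁ h₂
    refine ⟨fun l => ?_, fun l => ?_, ?_, ?_, ?_, ?_, ?_⟩
    · simpa [blueLoads_cons, Group.blueType] using hb l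
    · have := hr l
      by_cases hl : l = i
      · subst hl
        simp only [redLoads_cons, Group.redType, if_true, Function.update_self]
        exact this.add_one hfull
      · simpa [redLoads_cons, Group.redType, hl, Ne.symm hl] using this
    all_goals
      simp only [Multiset.mem_cons, forall_eq_or_imp]
      grind [Group.redType, Group.blueType]

theorem BinsInv.placeBlue {B B' : Multiset (Bin k)} {nb nr : Fin k → ℕ} {i : Fin k}
    (h : A.BinsInv B nb nr) (hB : A.PlaceBlue i B B') :
    A.BinsInv B' (Function.update nb i (nb i + 1)) nr := by
  have hInv := h
  obtain ⟨hb, hr, hb0, hr0, ht, hs, hc⟩ := h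
  cases hB with
  | single b M hφ hav =>
    obtain ⟨-, hg, -⟩ := hav
    rcases b with ⟨g, n, m⟩
    subst hg
    simp only [Multiset.mem_cons, forall_eq_or_imp] at hb0 hr0 ht hs hc
    refine ⟨fun l => ?_, fun l => ?_, ?_, ?_, ?_, ?_, ?_⟩
    · have := hb l
      by_cases hl : l = i
      · subst hl
        simp only [blueLoads_cons, Group.blueType, if_true, Function.update_self] at this ⊢
        exact this.incr
      · simpa [blueLoads_cons, Group.blueType, hl, Ne.symm hl] using this
    · simpa [redLoads_cons, Group.redType] using hr l
    all_goals
      simp only [Multiset.mem_cons, forall_eq_or_imp]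
      grind [Group.redType, Group.blueType]
  | newSingle _ hφ h₁ =>
    have hfull := hInv.le_blueLoads_of_single hφ h₁
    refine ⟨fun l => ?_, fun l => ?_, ?_, ?_, ?_, ?_, ?_⟩
    · have := hb l
      by_cases hl : l = i
      · subst hl
        simp only [blueLoads_cons, Group.blueType, if_true, Function.update_self]
        exact this.add_one hfull
      · simpa [blueLoads_cons, Group.blueType, hl, Ne.symm hl] using this
    · simpa [redLoads_cons, Group.redType] using hr l
    all_goals
      simp only [Multiset.mem_cons, forall_eq_or_imp]
      grind [Group.redType, Group.blueType]
  | add b M hφ hav =>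
    obtain ⟨-, hg, -⟩ := hav
    rcases b with ⟨g, n, m⟩
    have hbt : g.blueType = some i := by
      rcases hg with hg | ⟨j, hg⟩ <;> simp only at hg <;> simp [hg, Group.blueType]
    simp only [Multiset.mem_cons, forall_eq_or_imp] at hb0 hr0 ht hs hc
    refine ⟨fun l => ?_, fun l => ?_, ?_, ?_, ?_, ?_, ?_⟩
    · have := hb l
      by_cases hl : l = i
      · subst hl
        simp only [blueLoads_cons, hbt, if_true, Function.update_self] at this ⊢
        exact this.incr
      · simpa [blueLoads_cons, hbt, hl, Ne.symm hl] using this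
    · simpa [redLoads_cons] using hr l
    all_goals
      simp only [Multiset.mem_cons, forall_eq_or_imp]
      grind
  | convert b M j hφ h₁ hg hj =>
    have hfull := hInv.le_blueLoads hφ h₁
    rcases b with ⟨g, n, m⟩
    subst hg
    simp only [Multiset.mem_cons, forall_eq_or_imp] at hb0 hr0 ht hs hc
    -- The converted bin enters the blue loads with load exactly 1.
    obtain rfl : n = 0 := hb0.1 rfl
    refine ⟨fun l => ?_, fun l => ?_, ?_, ?_, ?_, ?_, ?_⟩
    · have := hb l
      by_cases hl : l = i
      · subst hl
        simp only [blueLoads_cons, Group.blueType, if_true, Function.update_self, reduceCtorEq,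
          if_false] at this hfull ⊢
        exact this.add_one hfull
      · simpa [blueLoads_cons, Group.blueType, hl, Ne.symm hl] using this
    · simpa [redLoads_cons, Group.redType] using hr l
    all_goals
      simp only [Multiset.mem_cons, forall_eq_or_imp]
      grind [Group.redType, Group.blueType]
  | newBin _ hφ h₁ h₂ =>
    have hfull := hInv.le_blueLoads hφ h₁
    refine ⟨fun l => ?_, fun l => ?_, ?_, ?_, ?_, ?_, ?_⟩
    · have := hb l
      by_cases hl : l = i
      · subst hl
        simp only [blueLoads_cons, Group.blueType, if_true, Function.update_self]
        exact this.add_one hfull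
      · simpa [blueLoads_cons, Group.blueType, hl, Ne.symm hl] using this
    · simpa [redLoads_cons, Group.redType] using hr l
    all_goals
      simp only [Multiset.mem_cons, forall_eq_or_imp]
      grind [Group.redType, Group.blueType]

/-! ### Counting the bins -/

/-- `J` is the largest `φ i` over the groups `(i,?)`, or `0` if there are none. A red class within
reach of `J` would fit into some `Δ (φ i)`, making two coexisting groups compatible. -/
theorem exists_space_index {B : Multiset (Bin k)} {nb nr : Fin k → ℕ} (h : A.BinsInv B nb nr) :
    ∃ J : Fin (K + 1), (∀ b ∈ B, ∀ i, b.group = .blueOnly i → A.φ i ≤ J) ∧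
      ∀ b ∈ B, ∀ j, b.group = .redOnly j → ∃ m : Fin K, A.redClass j = m ∧ (J : ℕ) ≤ m := by
  classical
  refine ⟨(Finset.univ.filter fun i => ∃ b ∈ B, b.group = .blueOnly i).sup A.φ,
    fun b hb i hi => Finset.le_sup (f := A.φ) (by simpa using ⟨b, hb, hi⟩), fun b hb j hj => ?_⟩
  obtain ⟨m, hm⟩ := exists_redClass (h.red_top b hb j (by simp [hj, Group.redType]))
  refine ⟨m, hm, ?_⟩
  have hlt : (Finset.univ.filter fun i => ∃ b ∈ B, b.group = .blueOnly i).sup A.φ < m.succ := by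
    rw [Finset.sup_lt_iff (Fin.succ_pos m)]
    intro i hi
    simp only [Finset.mem_filter, Finset.mem_univ, true_and] at hi
    obtain ⟨b', hb', hi⟩ := hi
    by_contra! hle
    exact h.not_compatible b' hb' b hb i j hi hj
      ((γ_mul_top_le hm).trans (A.Δ_mono.monotone hle))
  -- The index `m` stands for space `m + 1`, so lying strictly above `J` means `J ≤ m`.
  exact Nat.lt_succ_iff.1 hlt

/-- A mixed bin may be counted once for each colour; only the covering of all bins by `I` and `R`
matters. -/
theorem card_le_sum_loads (B : Multiset (Bin k)) (I R : Finset (Fin k))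
    (h : ∀ b ∈ B, (∃ i ∈ I, b.group.blueType = some i) ∨ ∃ j ∈ R, b.group.redType = some j) :
    Multiset.card B ≤ ∑ i ∈ I, Multiset.card (blueLoads i B) +
      ∑ j ∈ R, Multiset.card (redLoads j B) := by
  induction B using Multiset.induction_on with
  | empty => simp
  | cons b B ih =>
    have ih := ih fun b' hb' => h b' (Multiset.mem_cons_of_mem hb')
    have hB (i : Fin k) : Multiset.card (blueLoads i (b ::ₘ B)) =
        Multiset.card (blueLoads i B) + if b.group.blueType = some i then 1 else 0 := by
      rw [blueLoads_cons]; split_ifs <;> simp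
    have hR (i : Fin k) : Multiset.card (redLoads i (b ::ₘ B)) =
        Multiset.card (redLoads i B) + if b.group.redType = some i then 1 else 0 := by
      rw [redLoads_cons]; split_ifs <;> simp
    simp only [hB, hR, Finset.sum_add_distrib, Multiset.card_cons]
    rcases h b (Multiset.mem_cons_self _ _) with ⟨i, hi, hbi⟩ | ⟨i, hi, hbi⟩
    · have : 1 ≤ ∑ l ∈ I, if b.group.blueType = some l then 1 else 0 := by
        refine le_trans ?_ (Finset.single_le_sum (fun _ _ => Nat.zero_le _) hi)
        simp [hbi]
      omega
    · have : 1 ≤ ∑ l ∈ R, if b.group.redType = some l then 1 else 0 := by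
        refine le_trans ?_ (Finset.single_le_sum (fun _ _ => Nat.zero_le _) hi)
        simp [hbi]
      omega

/-! ### Thresholds and item types -/

theorem ε_lt_one : A.ε < 1 := by
  have h : (0 : Fin (k + 1)) < Fin.last k := Fin.lt_def.2 A.k_pos
  have := A.t_anti h
  rwa [A.t_first] at this

theorem not_lt_of_mem_interval {x : ℝ} {i j : Fin k} (hi : x ∈ A.interval i)
    (hj : x ∈ A.interval j) : ¬ i < j := by
  intro hij
  have h : A.t j.castSucc ≤ A.t i.succ := A.t_anti.antitone (by simpa [Fin.le_def] using hij)
  exact absurd (hi.1.trans_le hj.2) (not_lt.2 h)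

/-- A slip is handed to the bin packing algorithm as an item of size `A.top i`; it must get the type
of its rectangles. -/
theorem itemType_top (i : Fin k) : A.itemType (A.top i) = some i := by
  have hi : A.top i ∈ A.interval i := ⟨A.t_anti (Fin.castSucc_lt_succ), le_rfl⟩
  have h : ∃ j, A.top i ∈ A.interval j := ⟨i, hi⟩
  rw [itemType, dif_pos h, Option.some_inj]
  exact le_antisymm (not_lt.1 (not_lt_of_mem_interval hi h.choose_spec))
    (not_lt.1 (not_lt_of_mem_interval h.choose_spec hi))

/-- Starting from `x ≤ t 0 = 1`, missing each interval in turn pushes `x` below the next threshold.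
-/
theorem le_ε_of_itemType_eq_none {x : ℝ} (hx : x ≤ 1) (h : A.itemType x = none) : x ≤ A.ε := by
  have hno : ¬ ∃ i, x ∈ A.interval i := by
    intro h'
    simp [itemType, dif_pos h'] at h
  have key : ∀ j : Fin (k + 1), x ≤ A.t j := by
    intro j
    induction j using Fin.induction with
    | zero => rwa [A.t_first]
    | succ i ih =>
      by_contra! hlt
      exact hno ⟨i, hlt, ih⟩
  exact key _

/-! ### Invariants of the bin packing algorithm -/

variable (A) in
/-- The properties of the states of the bin packing algorithm on large items. -/
structure PackingInv (S : State k) : Prop where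
  e_eq : ∀ i, S.e i = ⌊A.α i * (S.s i : ℝ)⌋₊
  smallBins : S.smallBins = 0
  bins : A.BinsInv S.bins (fun i => S.s i - S.e i) S.e

theorem PackingInv.e_le {S : State k} (h : A.PackingInv S) (i : Fin k) : S.e i ≤ S.s i := by
  rw [h.e_eq]
  refine Nat.floor_le_of_le ?_
  exact mul_le_of_le_one_left (Nat.cast_nonneg _) (A.α_le_one i)

theorem PackingInv.init : A.PackingInv (State.init k) := by
  refine ⟨fun i => by simp [State.init], rfl, ?_⟩
  exact binsInv_zero

/-- Since `0 ≤ α i ≤ 1`, the floor of `α i * s i` rises by 0 or 1 with each item, so the colouring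
rule keeps the red count equal to it. -/
theorem PackingInv.step {S T : State k} {x : ℝ} {i : Fin k} (h : A.PackingInv S)
    (hx : A.itemType x = some i) (hT : A.Step x S T) :
    A.PackingInv T ∧ T.s = Function.update S.s i (S.s i + 1) := by
  have hle := h.e_le
  cases hT with
  | smallFit u hx' => simp [hx] at hx'
  | smallNew hx' => simp [hx] at hx'
  | red j B' hx' hcol hB =>
    obtain rfl : i = j := by simpa [hx] using hx'
    -- Types that fit into no space have `α i = 0`, so the target number of red items is 0.
    have hi : A.top i ≤ A.Δ (Fin.last K) := by
      by_contra! hlt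
      simp [A.α_eq_zero i hlt] at hcol
    refine ⟨⟨fun l => ?_, h.smallBins, ?_⟩, rfl⟩
    · by_cases hl : l = i
      · subst hl
        simp only [Function.update_self]
        refine le_antisymm hcol ?_
        rw [h.e_eq, ← Nat.floor_add_one (mul_nonneg (A.α_nonneg _) (Nat.cast_nonneg _))]
        refine Nat.floor_le_floor ?_
        have := A.α_le_one l
        push_cast
        linarith
      · simpa [hl] using h.e_eq l
    · convert h.bins.placeRed hi hB using 1
      funext l
      by_cases hl : l = i
      · subst hl; simp
      · simp [hl]
  | blue j B' hx' hcol hB =>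
    obtain rfl : i = j := by simpa [hx] using hx'
    refine ⟨⟨fun l => ?_, h.smallBins, ?_⟩, rfl⟩
    · by_cases hl : l = i
      · subst hl
        simp only [Function.update_self]
        refine le_antisymm ?_ (not_lt.1 hcol)
        rw [h.e_eq]
        refine Nat.floor_le_floor ?_
        have := A.α_nonneg l
        push_cast
        linarith
      · simpa [hl] using h.e_eq l
    · convert h.bins.placeBlue hB using 1
      funext l
      by_cases hl : l = i
      · subst hl
        have := hle l
        simp only [Function.update_self]
        omega
      · simp [hl]

/-! ### Invariants of the strip packing algorithm -/

variable (A) in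
/-- The weight of the sizes of type `i`. -/
noncomputable def typeWeight (i : Fin k) : WeightSpace K :=
  ((1 - A.α i) / A.β i) • bVec (A.φ i) + (A.α i / A.γ i) • rVec (A.redClass i)

theorem weight_of_some {x : ℝ} {i : Fin k} (h : A.itemType x = some i) :
    A.weight x = A.typeWeight i := by
  simp [weight, h, typeWeight]

theorem weight_of_none {x : ℝ} (h : A.itemType x = none) :
    A.weight x = (x / (1 - A.ε)) • bVec 0 := by
  simp [weight, h]

variable (A) in
/-- The height `r ^ s` of an open shelf, diminished in proportion to its used width. -/
noncomputable def shelfSlack (r : ℝ) (s : ℕ) : Option ℝ → ℝ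
  | none => 0
  | some u => r ^ s * (1 - u / (1 - A.ε))

/-- If `s` is not in `F`, there was no shelf of height `r ^ s`, and its old slack is 0. -/
theorem sum_shelfSlack_update (r : ℝ) (f : ℕ → Option ℝ) {F : Finset ℕ}
    (hF : ∀ t ∉ F, f t = none) (s : ℕ) (v : Option ℝ) :
    ∑ t ∈ insert s F, A.shelfSlack r t (Function.update f s v t) =
      ∑ t ∈ F, A.shelfSlack r t (f t) - A.shelfSlack r s (f s) + A.shelfSlack r s v := by
  have h : ∑ t ∈ insert s F, A.shelfSlack r t (f t) = ∑ t ∈ F, A.shelfSlack r t (f t) :=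
    Finset.sum_insert_of_eq_zero_if_notMem fun hs => by simp [hF s hs, shelfSlack]
  rw [← h, ← Finset.add_sum_erase _ _ (Finset.mem_insert_self s F),
    ← Finset.add_sum_erase _ (fun t => A.shelfSlack r t (f t)) (Finset.mem_insert_self s F)]
  have : ∑ t ∈ (insert s F).erase s, A.shelfSlack r t (Function.update f s v t) =
      ∑ t ∈ (insert s F).erase s, A.shelfSlack r t (f t) :=
    Finset.sum_congr rfl fun t ht => by simp [Finset.ne_of_mem_erase ht]
  rw [this, Function.update_self]
  ring

variable (A) in
/-- The properties of the states `S` of the strip packing algorithm: `w` is the total weight of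
the rectangles so far, and `W` is the `b₀`-component that is due to the narrow ones. -/
structure GPInv (r c : ℝ) (w : WeightSpace K) (W : ℝ) (S : GPState k) : Prop where
  packing : A.PackingInv S.packing
  weight_eq : w = ∑ i, (S.slips i).sum • A.typeWeight i + W • bVec 0
  nonneg : 0 ≤ W
  slips_card : ∀ i, Multiset.card (S.slips i) = S.packing.s i
  -- At most one slip of each type falls short of `c - 1`.
  slips_le : ∀ i, (c - 1) * (Multiset.card (S.slips i) : ℝ) ≤ (S.slips i).sum + (c - 1)
  slips_nonneg : ∀ i, 0 ≤ (S.slips i).sum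
  shelf_nonneg : ∀ s u, S.shelf s = some u → 0 ≤ u
  -- A potential argument: opening a shelf adds its height to the slack, and each narrow rectangle
  -- moves part of it into `W / r`. The finite set `F` makes the sum over shelves meaningful.
  shelf_le : ∃ F : Finset ℕ, (∀ s ∉ F, S.shelf s = none) ∧
    S.shelfHeight ≤ W / r + ∑ s ∈ F, A.shelfSlack r s (S.shelf s)

theorem GPInv.init (r : ℝ) {c : ℝ} (hc : 1 < c) : A.GPInv r c 0 0 (GPState.init k) where
  packing := PackingInv.init
  weight_eq := by simp [GPState.init]
  nonneg := le_rfl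
  slips_card i := by simp [GPState.init, State.init]
  slips_le i := by simp [GPState.init, hc.le]
  slips_nonneg i := by simp [GPState.init]
  shelf_nonneg s u h := by simp [GPState.init] at h
  shelf_le := ⟨∅, by simp [GPState.init]⟩

theorem sum_slips_update (f : Fin k → Multiset ℝ) (i : Fin k) (M : Multiset ℝ) {y : ℝ}
    (hM : M.sum = (f i).sum + y) :
    ∑ j, (Function.update f i M j).sum • A.typeWeight j =
      ∑ j, (f j).sum • A.typeWeight j + y • A.typeWeight i := by
  have h : ∀ j, (Function.update f i M j).sum • A.typeWeight j =
      (f j).sum • A.typeWeight j + if j = i then y • A.typeWeight i else 0 := by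
    intro j
    by_cases hj : j = i
    · subst hj; simp [hM, add_smul]
    · simp [hj]
  simp [h, Finset.sum_add_distrib]

theorem narrow_le {r : ℝ} (hr₀ : 0 < r) {x y : ℝ} {s : ℕ} (hx : 0 < x) (hy : r ^ (s + 1) < y) :
    r ^ s * (x / (1 - A.ε)) ≤ y * (x / (1 - A.ε)) / r := by
  have hε : 0 < 1 - A.ε := sub_pos.2 ε_lt_one
  rw [le_div_iff₀ hr₀]
  calc _ = r ^ (s + 1) * (x / (1 - A.ε)) := by ring
    _ ≤ _ := mul_le_mul_of_nonneg_right hy.le (by positivity)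

theorem GPInv.step {r c : ℝ} (hr₀ : 0 < r) {w : WeightSpace K} {W : ℝ}
    {P : ℝ × ℝ} {S T : GPState k} (h : A.GPInv r c w W S)
    (hP : (0 < P.1 ∧ P.1 ≤ 1) ∧ (0 < P.2 ∧ P.2 ≤ 1)) (hT : A.GPStep r c P S T) :
    ∃ W', A.GPInv r c (w + A.rectWeight P) W' T := by
  have hε : 0 < 1 - A.ε := sub_pos.2 ε_lt_one
  obtain ⟨⟨hx0, hx1⟩, hy0, hy1⟩ := hP
  obtain ⟨hp, hw, hW, hcard, hle, hnn, hshn, F, hF, hsh⟩ := h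
  cases hT with
  | shelfFit s u ht hs₁ hs₂ hu hfit =>
    have hu0 := hshn s u hu
    have hn := narrow_le (A := A) hr₀ hx0 hs₁
    refine ⟨W + P.2 * (P.1 / (1 - A.ε)), hp, ?_, by positivity, hcard, hle, hnn, ?_,
      insert s F, ?_, ?_⟩
    · rw [rectWeight, weight_of_none ht, hw]
      module
    · intro l v hv
      by_cases hl : l = s
      · subst hl
        simp only [Function.update_self, Option.some_inj] at hv
        linarith
      · exact hshn l v (by simpa [hl] using hv)
    · intro l hl
      simp only [Finset.mem_insert, not_or] at hl
      simpa [hl.1] using hF l hl.2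
    · simp only
      rw [sum_shelfSlack_update r _ hF, hu, shelfSlack, shelfSlack, add_div, add_div]
      linarith
  | shelfNew s ht hs₁ hs₂ hno =>
    have hn := narrow_le (A := A) hr₀ hx0 hs₁
    refine ⟨W + P.2 * (P.1 / (1 - A.ε)), hp, ?_, by positivity, hcard, hle, hnn, ?_,
      insert s F, ?_, ?_⟩
    · rw [rectWeight, weight_of_none ht, hw]
      module
    · intro l v hv
      by_cases hl : l = s
      · subst hl
        simp only [Function.update_self, Option.some_inj] at hv
        linarith
      · exact hshn l v (by simpa [hl] using hv)
    · intro l hl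
      simp only [Finset.mem_insert, not_or] at hl
      simpa [hl.1] using hF l hl.2
    · have hold : A.shelfSlack r s (S.shelf s) ≤ 0 := by
        rcases hu : S.shelf s with _ | u
        · exact le_rfl
        · have h1 := hno u hu
          have h2 := le_ε_of_itemType_eq_none hx1 ht
          have h3 : 1 ≤ u / (1 - A.ε) := (one_le_div hε).2 (by linarith)
          exact mul_nonpos_of_nonneg_of_nonpos (by positivity) (by linarith)
      simp only
      rw [sum_shelfSlack_update r _ hF, shelfSlack, add_div]
      linarith
  | slipFit i h M ht hM hh =>
    have hsum : ((h + P.2) ::ₘ M).sum = (S.slips i).sum + P.2 := by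
      rw [hM, Multiset.sum_cons, Multiset.sum_cons]; ring
    have hcd : Multiset.card ((h + P.2) ::ₘ M) = Multiset.card (S.slips i) := by
      simp [hM]
    refine ⟨W, hp, ?_, hW, fun l => ?_, fun l => ?_, fun l => ?_, hshn, F, hF, hsh⟩
    · rw [rectWeight, weight_of_some ht, hw]
      simp only
      rw [sum_slips_update _ _ _ hsum]
      module
    all_goals
      by_cases hl : l = i
      · subst hl
        have h1 := hcard l
        have h2 := hle l
        have h3 := hnn l
        simp only [Function.update_self, hsum, hcd]
        linarith
      · simpa [hl] using by first | exact hcard l | exact hle l | exact hnn l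
  | slipNew i T ht hno hT =>
    obtain ⟨hp', hs'⟩ := hp.step (itemType_top i) hT
    have hsum : (P.2 ::ₘ S.slips i).sum = (S.slips i).sum + P.2 := by
      rw [Multiset.sum_cons, add_comm]
    -- All existing slips of the type reach `c - 1`, so only the new one can be short.
    have hfull : (c - 1) * (Multiset.card (S.slips i) : ℝ) ≤ (S.slips i).sum := by
      have := Multiset.card_nsmul_le_sum (s := S.slips i) (a := c - 1)
        fun h hh => not_lt.1 (hno h hh)
      rwa [nsmul_eq_mul, mul_comm] at this
    refine ⟨W, hp', ?_, hW, fun l => ?_, fun l => ?_, fun l => ?_, hshn, F, hF, hsh⟩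
    · rw [rectWeight, weight_of_some ht, hw]
      simp only
      rw [sum_slips_update _ _ _ hsum]
      module
    · by_cases hl : l = i
      · subst hl
        simp [hs', hcard l]
      · simpa [hs', hl] using hcard l
    · by_cases hl : l = i
      · subst hl
        simp only [Function.update_self, hsum, Multiset.card_cons]
        push_cast
        linarith
      · simpa [hl] using hle l
    · by_cases hl : l = i
      · subst hl
        have := hnn l
        simp only [Function.update_self, hsum]
        linarith
      · simpa [hl] using hnn l

theorem GPRun.exists_inv {r c : ℝ} (hr₀ : 0 < r) (hc : 1 < c) {L : List (ℝ × ℝ)}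
    {S : GPState k} (hS : A.GPRun r c L S)
    (hL : ∀ P ∈ L, (0 < P.1 ∧ P.1 ≤ 1) ∧ (0 < P.2 ∧ P.2 ≤ 1)) :
    ∃ W, A.GPInv r c (L.map A.rectWeight).sum W S := by
  induction hS with
  | nil => exact ⟨0, by simpa using GPInv.init r hc⟩
  | snoc L P S S' _ hP ih =>
    obtain ⟨W, hW⟩ := ih fun Q hQ => hL Q (by simp [hQ])
    simpa using hW.step hr₀ (hL P (by simp)) hP

theorem sum_shelfSlack_le {r : ℝ} (hr₀ : 0 < r) (hr₁ : r < 1) {f : ℕ → Option ℝ}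
    (hf : ∀ s u, f s = some u → 0 ≤ u) (F : Finset ℕ) :
    ∑ s ∈ F, A.shelfSlack r s (f s) ≤ 1 / (1 - r) := by
  have hε : 0 < 1 - A.ε := sub_pos.2 ε_lt_one
  calc ∑ s ∈ F, A.shelfSlack r s (f s) ≤ ∑ s ∈ F, r ^ s := by
        refine Finset.sum_le_sum fun s _ => ?_
        rcases hs : f s with _ | u
        · exact (pow_pos hr₀ s).le
        · have : 0 ≤ u / (1 - A.ε) := div_nonneg (hf s u hs) hε.le
          exact mul_le_of_le_one_right (pow_pos hr₀ s).le (by linarith)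
    _ ≤ ∑' s, r ^ s := (summable_geometric_of_lt_one hr₀.le hr₁).sum_le_tsum _
        fun s _ => (pow_pos hr₀ s).le
    _ = 1 / (1 - r) := by rw [tsum_geometric_of_lt_one hr₀.le hr₁, one_div]

/-! ### The weight bounds the cost -/

theorem rVec_inr (x : WithTop (Fin K)) (m : Fin K) :
    rVec x (Sum.inr m) = if x = m then 1 else 0 := by
  induction x using WithTop.recTopCoe with
  | top => exact (if_neg WithTop.top_ne_coe).symm
  | coe n =>
    change (Pi.single (Sum.inr n) 1 : WeightSpace K) (Sum.inr m) = _
    simp [Pi.single_apply, eq_comm]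

theorem rVec_inl (x : WithTop (Fin K)) (m : Fin (K + 1)) : rVec x (Sum.inl m) = 0 := by
  rcases x with _ | n <;> simp [rVec]

theorem sum_red_coord (H : Fin k → ℝ) (W : ℝ) (T : Finset (Fin K)) :
    ∑ m ∈ T, (∑ i, H i • A.typeWeight i + W • bVec 0 : WeightSpace K) (Sum.inr m) =
      ∑ i with ∃ m ∈ T, A.redClass i = m, H i * (A.α i / A.γ i) := by
  have h : ∀ m, (∑ i, H i • A.typeWeight i + W • bVec 0 : WeightSpace K) (Sum.inr m) =
      ∑ i, if A.redClass i = m then H i * (A.α i / A.γ i) else 0 := by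
    intro m
    simp only [Pi.add_apply, Finset.sum_apply, Pi.smul_apply, typeWeight, bVec, smul_eq_mul]
    rw [Pi.single_eq_of_ne (by simp), mul_zero, add_zero]
    refine Finset.sum_congr rfl fun i _ => ?_
    rw [Pi.single_eq_of_ne (by simp), mul_zero, zero_add]
    simp [rVec_inr]
  simp only [h]
  rw [Finset.sum_comm, Finset.sum_filter]
  refine Finset.sum_congr rfl fun i _ => ?_
  split_ifs with hi
  · obtain ⟨m, hm, hi⟩ := hi
    simp [hi, hm]
  · push Not at hi
    exact Finset.sum_eq_zero fun m hm => if_neg (hi m hm)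

theorem sum_blue_coord (H : Fin k → ℝ) (W : ℝ) {T : Finset (Fin (K + 1))} (hT : 0 ∈ T) :
    ∑ m ∈ T, (∑ i, H i • A.typeWeight i + W • bVec 0 : WeightSpace K) (Sum.inl m) =
      ∑ i with A.φ i ∈ T, H i * ((1 - A.α i) / A.β i) + W := by
  have h : ∀ m, (∑ i, H i • A.typeWeight i + W • bVec 0 : WeightSpace K) (Sum.inl m) =
      ∑ i, (if A.φ i = m then H i * ((1 - A.α i) / A.β i) else 0) + if 0 = m then W else 0 := by
    intro m
    simp only [Pi.add_apply, Finset.sum_apply, Pi.smul_apply, typeWeight, bVec, smul_eq_mul]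
    congr 1
    · refine Finset.sum_congr rfl fun i _ => ?_
      rw [rVec_inl]
      by_cases hn : A.φ i = m
      · subst hn; simp
      · have : (Sum.inl m : Fin (K + 1) ⊕ Fin K) ≠ Sum.inl (A.φ i) := by simpa using Ne.symm hn
        simp [this, hn]
    · by_cases hn : 0 = m
      · subst hn; simp
      · have : (Sum.inl m : Fin (K + 1) ⊕ Fin K) ≠ Sum.inl 0 := by simpa using Ne.symm hn
        simp [this, hn]
  simp only [h]
  rw [Finset.sum_add_distrib, Finset.sum_comm, Finset.sum_filter]
  simp [hT]

/-- The maximum is bounded below by its term at `J`; the separate `b₀` coordinate is absorbed into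
both blue sums. -/
theorem le_consolidation {x : WeightSpace K} {a : ℝ} (J : Fin (K + 1))
    (h₁ : a ≤ ∑ m ∈ {m : Fin K | (J : ℕ) ≤ m}, x (Sum.inr m) + ∑ m, x (Sum.inl m))
    (h₂ : a ≤ ∑ m : Fin K, x (Sum.inr m) + ∑ m : Fin (K + 1) with m ≤ J, x (Sum.inl m)) :
    a ≤ consolidation x := by
  have e₁ : ∑ m, x (Sum.inl m) = x (Sum.inl 0) + ∑ i : Fin K, x (Sum.inl i.succ) :=
    Fin.sum_univ_succ _
  have e₂ : ∑ m : Fin (K + 1) with m ≤ J, x (Sum.inl m) =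
      x (Sum.inl 0) + ∑ i ∈ {i : Fin K | (i : ℕ) < J}, x (Sum.inl i.succ) := by
    rw [Finset.sum_filter, Fin.sum_univ_succ, Finset.sum_filter]
    simp [Fin.le_def]
  rw [e₁] at h₁
  rw [e₂] at h₂
  rw [consolidation, ← sub_le_iff_le_add']
  refine (Finset.le_sup'_iff _).2 ⟨J, Finset.mem_univ J, le_min ?_ ?_⟩ <;> linarith

/-- Here `N` bins hold `a` items of one colour, a proportion `p` of `s` slips of total packed height
`H`. Three roundings, for the unfinished bin, the colour count and the short slip, cost at most `c`
each because `p / b ≤ 1` and `1 / b ≤ 1`. -/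
theorem card_le_of_filled {a N s H c M p b : ℝ} (hc : 1 < c) (hM : c / (c - 1) ≤ M) (hH : 0 ≤ H)
    (hs : (c - 1) * s ≤ H + (c - 1)) (hp₀ : 0 ≤ p) (hp₁ : p ≤ 1) (hb : 1 ≤ b)
    (hN : b * N ≤ a + b) (ha : a ≤ p * s + 1) :
    c * N ≤ M * (H * (p / b)) + 3 * c := by
  have hb0 : 0 < b := by linarith
  have hc1 : 0 < c - 1 := by linarith
  have h1 : c * s ≤ M * H + c := by
    have h2 : s ≤ H / (c - 1) + 1 := by
      rw [div_add_one hc1.ne', le_div_iff₀ hc1]; linarith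
    have h3 : c * s ≤ c / (c - 1) * H + c := by
      calc c * s ≤ c * (H / (c - 1) + 1) := by gcongr
        _ = _ := by ring
    have := mul_le_mul_of_nonneg_right hM hH
    linarith
  have hq0 : 0 ≤ p / b := by positivity
  have hq1 : p / b ≤ 1 := (div_le_one hb0).2 (hp₁.trans hb)
  have hN' : N ≤ p / b * s + 1 / b + 1 := by
    have : N ≤ (a + b) / b := by rw [le_div_iff₀ hb0]; linarith
    calc N ≤ (a + b) / b := this
      _ ≤ (p * s + 1 + b) / b := by gcongr
      _ = _ := by field_simp
  have hb1 : 1 / b ≤ 1 := (div_le_one hb0).2 hb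
  calc c * N ≤ c * (p / b * s + 1 + 1) := by gcongr; linarith
    _ = p / b * (c * s) + 2 * c := by ring
    _ ≤ p / b * (M * H + c) + 2 * c := by gcongr
    _ = M * (H * (p / b)) + p / b * c + 2 * c := by ring
    _ ≤ M * (H * (p / b)) + 1 * c + 2 * c := by gcongr
    _ = _ := by ring

theorem GPInv.cost_le {r c : ℝ} (hr₀ : 0 < r) (hr₁ : r < 1) (hc : 1 < c) {w : WeightSpace K}
    {W : ℝ} {S : GPState k} (h : A.GPInv r c w W S) :
    S.cost c ≤ max (c / (c - 1)) (1 / r) * consolidation w + (1 / (1 - r) + 6 * c * k) := by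
  set M := max (c / (c - 1)) (1 / r) with hMdef
  have hMpos : 0 < M := lt_max_of_lt_right (by positivity)
  have hc0 : 0 < c := by linarith
  obtain ⟨F, -, hF⟩ := h.shelf_le
  have hshelf : S.shelfHeight ≤ M * W + 1 / (1 - r) := by
    have h1 := sum_shelfSlack_le (A := A) hr₀ hr₁ h.shelf_nonneg F
    have h2 : 1 / r * W ≤ M * W := mul_le_mul_of_nonneg_right (le_max_right _ _) h.nonneg
    have h3 : W / r = 1 / r * W := by ring
    linarith
  set H : Fin k → ℝ := fun i => (S.slips i).sum with hH
  have hslip (i : Fin k) : (c - 1) * (S.packing.s i : ℝ) ≤ H i + (c - 1) := by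
    have := h.slips_le i
    rwa [h.slips_card] at this
  have hαs (i : Fin k) : 0 ≤ A.α i * (S.packing.s i : ℝ) :=
    mul_nonneg (A.α_nonneg i) (Nat.cast_nonneg _)
  have hblue (i : Fin k) : c * (Multiset.card (blueLoads i S.packing.bins) : ℝ) ≤
      M * (H i * ((1 - A.α i) / A.β i)) + 3 * c := by
    have hN : ((A.β i * Multiset.card (blueLoads i S.packing.bins) : ℕ) : ℝ) ≤
        ((S.packing.s i - S.packing.e i + A.β i : ℕ) : ℝ) :=
      Nat.cast_le.2 (h.packing.bins.blue i).2
    rw [Nat.cast_mul, Nat.cast_add, Nat.cast_sub (h.packing.e_le i)] at hN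
    refine card_le_of_filled hc (le_max_left _ _) (h.slips_nonneg i) (hslip i)
      (sub_nonneg.2 (A.α_le_one i)) (by linarith [A.α_nonneg i])
      (by exact_mod_cast A.β_pos i) hN ?_
    -- The blue items number `s - ⌊α * s⌋ < (1 - α) * s + 1`.
    have := Nat.lt_floor_add_one (A.α i * (S.packing.s i : ℝ))
    rw [← h.packing.e_eq] at this
    linarith
  have hred (i : Fin k) (m : Fin K) (hm : A.redClass i = m) :
      c * (Multiset.card (redLoads i S.packing.bins) : ℝ) ≤
        M * (H i * (A.α i / A.γ i)) + 3 * c := by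
    have hN : ((A.γ i * Multiset.card (redLoads i S.packing.bins) : ℕ) : ℝ) ≤
        ((S.packing.e i + A.γ i : ℕ) : ℝ) := Nat.cast_le.2 (h.packing.bins.red i).2
    rw [Nat.cast_mul, Nat.cast_add] at hN
    refine card_le_of_filled hc (le_max_left _ _) (h.slips_nonneg i) (hslip i)
      (A.α_nonneg i) (A.α_le_one i) (by exact_mod_cast one_le_γ hm) hN ?_
    have := Nat.floor_le (hαs i)
    rw [← h.packing.e_eq] at this
    linarith
  -- Any covering of the bins by blue types `I` and red types `R` bounds the cost. The error `3 * c`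
  -- arises at most once per type and colour, hence `6 * c * k`.
  have hcount (I R : Finset (Fin k)) (hR : ∀ j ∈ R, ∃ m : Fin K, A.redClass j = m)
      (hIR : ∀ b ∈ S.packing.bins, (∃ i ∈ I, b.group.blueType = some i) ∨
        ∃ j ∈ R, b.group.redType = some j) :
      S.cost c ≤ M * (∑ j ∈ R, H j * (A.α j / A.γ j) +
        (∑ i ∈ I, H i * ((1 - A.α i) / A.β i) + W)) + (1 / (1 - r) + 6 * c * k) := by
    have hcard : (Multiset.card S.packing.bins : ℝ) ≤
        ∑ i ∈ I, (Multiset.card (blueLoads i S.packing.bins) : ℝ) +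
          ∑ j ∈ R, (Multiset.card (redLoads j S.packing.bins) : ℝ) := by
      exact_mod_cast card_le_sum_loads S.packing.bins I R hIR
    have hI := Finset.sum_le_sum fun i (_ : i ∈ I) => hblue i
    have hR' := Finset.sum_le_sum fun j (hj : j ∈ R) => hred j _ (hR j hj).choose_spec
    rw [Finset.sum_add_distrib, ← Finset.mul_sum, ← Finset.mul_sum, Finset.sum_const,
      nsmul_eq_mul] at hI hR'
    have hcardle (U : Finset (Fin k)) : (U.card : ℝ) * (3 * c) ≤ k * (3 * c) := by
      gcongr
      simpa using Finset.card_le_univ U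
    have h1 := hcardle I
    have h2 := hcardle R
    have h3 := mul_le_mul_of_nonneg_left hcard hc0.le
    rw [GPState.cost, State.cost, h.packing.smallBins, add_zero]
    linarith
  obtain ⟨J, hJb, hJr⟩ := exists_space_index h.packing.bins
  -- Dividing by `M` first makes homogeneity of `consolidation` unnecessary.
  rw [← sub_le_iff_le_add, ← div_le_iff₀' hMpos]
  refine le_consolidation J ?_ ?_
  -- First covering: every bin outside the groups `(?,j)` is charged to its blue items, and those
  -- groups have red class beyond `J`.
  · rw [h.weight_eq, sum_red_coord, sum_blue_coord H W (Finset.mem_univ _),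
      div_le_iff₀' hMpos, sub_le_iff_le_add]
    refine hcount _ _ (fun j hj => ?_) fun b hb => ?_
    · simp only [Finset.mem_filter, Finset.mem_univ, true_and] at hj
      obtain ⟨m, -, hm⟩ := hj
      exact ⟨m, hm⟩
    · simp only [Finset.mem_filter, Finset.mem_univ, true_and]
      rcases hg : b.group with i | i | j | ⟨i, j⟩
      · exact Or.inl ⟨i, rfl⟩
      · exact Or.inl ⟨i, rfl⟩
      · obtain ⟨m, hm, hle⟩ := hJr b hb j hg
        exact Or.inr ⟨j, ⟨m, hle, hm⟩, rfl⟩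
      · exact Or.inl ⟨i, rfl⟩
  -- Second covering: every bin with a red type is charged to it. The others are `(i)`, where `φ i =
  -- 0`, and `(i,?)`, where `φ i ≤ J`.
  · rw [h.weight_eq, sum_red_coord, sum_blue_coord H W (by simp),
      div_le_iff₀' hMpos, sub_le_iff_le_add]
    have hmem : ∀ b ∈ S.packing.bins, ∀ j, b.group.redType = some j →
        ∃ m : Fin K, A.redClass j = m :=
      fun b hb j hj => exists_redClass (h.packing.bins.red_top b hb j hj)
    refine hcount _ _ (fun j hj => ?_) fun b hb => ?_
    · simp only [Finset.mem_filter, Finset.mem_univ, true_and] at hj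
      exact hj
    · simp only [Finset.mem_filter, Finset.mem_univ, true_and]
      rcases hg : b.group with i | i | j | ⟨i, j⟩
      · have := (h.packing.bins.single_iff b hb i (by simp [hg, Group.blueType])).1 hg
        exact Or.inl ⟨i, by simp [this], rfl⟩
      · exact Or.inl ⟨i, hJb b hb i hg, rfl⟩
      · exact Or.inr ⟨j, hmem b hb j (by simp [hg, Group.redType]), rfl⟩
      · exact Or.inr ⟨j, hmem b hb j (by simp [hg, Group.redType]), rfl⟩

end SuperHarmonic

theorem mainTheorem5 {k K : ℕ} (A : SuperHarmonic k K) (r c : ℝ)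
    (hr₀ : 0 < r) (hr₁ : r < 1) (hc : 1 < c) :
    ∃ C : ℝ, ∀ L : List (ℝ × ℝ),
      (∀ P ∈ L, (0 < P.1 ∧ P.1 ≤ 1) ∧ (0 < P.2 ∧ P.2 ≤ 1)) →
      ∀ S : SuperHarmonic.GPState k, A.GPRun r c L S →
        S.cost c ≤
          max (c / (c - 1)) (1 / r) * SuperHarmonic.consolidation (L.map A.rectWeight).sum + C := by
  refine ⟨1 / (1 - r) + 6 * c * k, fun L hL S hS => ?_⟩
  obtain ⟨W, hW⟩ := hS.exists_inv hr₀ hc hL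
  exact hW.cost_le hr₀ hr₁ hc
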